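/- Let $(\Omega,\mathcal F,\mathbb Q)$ be a probability space and let $Z=(Z_t)_{t\ge 0}$ be a subordinator on it, i.e. a real-valued Lévy process with almost surely non-decreasing paths. Let $$\kappa(\theta)=\ln E_{\mathbb Q}\left[e^{\theta Z_1}\right],\qquad \theta\in\mathbb R,$$ be the cumulant generating function of $Z_1$, and assume that $\hat\kappa=\sup\{\theta\in\mathbb R:\kappa(\theta)<\infty\}>0$. Fix $\lambda>0$, $T>0$ and $\rho\in\mathbb R$ with $\rho\le 0$, and put $$P_T=e^{\rho Z_{\lambda T}-\lambda T\kappa(\rho)},\qquad G_n=E_{\mathbb Q}\left[\left(-\lambda T\kappa(\rho)\left(\tfrac12 e^{-\lambda T\kappa(\rho)}+\tfrac12\right)+|\rho|Z_{\lambda T}\right)^{n}\right],\quad n\in\mathbb N_0 .$$ Let $N\in\mathbb N_0$ be such that $\kappa$ is (finite and) $N$ times continuously differentiable in an open interval containing $0$. Then $(P_T-1)^N$ and the random variables in the definition of $G_0,\dots,G_N$ are $\mathbb Q$-integrable, $$\left|E_{\mathbb Q}\left[(P_T-1)^N\right]\right|\le G_N,$$ and $G_0,\dots,G_N$ satisfy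 $G_0=1$ and, for all $h=1,\dots,N$, $$G_h=-\lambda T\kappa(\rho)\left(\tfrac12 e^{-\lambda T\kappa(\rho)}+\tfrac12\right)G_{h-1}+\sum_{i=1}^{h}\binom{h-1}{i-1}G_{h-i}\,\kappa^{(i)}(0)\,\lambda T|\rho|^{i}.$$ -/

import Mathlib

open MeasureTheory ProbabilityTheory Filter Topology
open scoped NNReal

noncomputable section

namespace BNS

variable {Ω : Type*} [MeasurableSpace Ω]

/-- A real-valued Lévy process indexed by `[0, ∞)`: it starts at `0`, has independent and
stationary increments, is stochastically continuous and has càdlàg paths. -/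
structure IsLevyProcess (Z : ℝ≥0 → Ω → ℝ) (Q : Measure Ω) : Prop where
  measurable : ∀ t, Measurable (Z t)
  zero : ∀ᵐ ω ∂Q, Z 0 ω = 0
  indep : HasIndepIncrements Z Q
  stationary : ∀ s t, IdentDistrib (fun ω => Z (s + t) ω - Z s ω) (Z t) Q Q
  stochContinuous : ∀ t, TendstoInMeasure Q Z (𝓝 t) (Z t)
  cadlag : ∀ᵐ ω ∂Q, ∀ t : ℝ≥0,
    ContinuousWithinAt (fun s => Z s ω) (Set.Ici t) t ∧
      ∃ l : ℝ, Tendsto (fun s => Z s ω) (𝓝[<] t) (𝓝 l)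

/-- A subordinator: a Lévy process with almost surely non-decreasing paths. -/
structure IsSubordinator (Z : ℝ≥0 → Ω → ℝ) (Q : Measure Ω) : Prop extends IsLevyProcess Z Q where
  mono : ∀ᵐ ω ∂Q, Monotone fun t => Z t ω

/-- The cumulant generating function `κ(θ) = ln E[exp (θ Z₁)]` (meaningful where the expectation
is finite). -/
def kappa (Z : ℝ≥0 → Ω → ℝ) (Q : Measure Ω) (θ : ℝ) : ℝ := cgf (Z 1) Q θ

/-- The set of `θ` with `κ(θ) < ∞`, that is, with `exp (θ Z₁)` integrable. -/
def kappaDomain (Z : ℝ≥0 → Ω → ℝ) (Q : Measure Ω) : Set ℝ := integrableExpSet (Z 1) Q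

/-- `sup {θ : κ(θ) < ∞}`, an extended real number. -/
def kappaHat (Z : ℝ≥0 → Ω → ℝ) (Q : Measure Ω) : EReal :=
  sSup ((fun θ : ℝ => (θ : EReal)) '' kappaDomain Z Q)

/-- `P_t = exp (ρ Z_{λt} - λ t κ(ρ))`. -/
def P (Z : ℝ≥0 → Ω → ℝ) (Q : Measure Ω) (lam : ℝ≥0) (ρ : ℝ) (t : ℝ≥0) (ω : Ω) : ℝ :=
  Real.exp (ρ * Z (lam * t) ω - lam * t * kappa Z Q ρ)

/-- The deterministic term `-λ T κ(ρ) (½ exp (-λ T κ(ρ)) + ½)`. -/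
def drift (Z : ℝ≥0 → Ω → ℝ) (Q : Measure Ω) (lam : ℝ≥0) (ρ : ℝ) (T : ℝ≥0) : ℝ :=
  -(lam * T * kappa Z Q ρ) * (1 / 2 * Real.exp (-(lam * T * kappa Z Q ρ)) + 1 / 2)

/-- `G_N = E[(-λ T κ(ρ) (½ exp (-λ T κ(ρ)) + ½) + |ρ| Z_{λT})^N]`. -/
def G (Z : ℝ≥0 → Ω → ℝ) (Q : Measure Ω) (lam : ℝ≥0) (ρ : ℝ) (T : ℝ≥0) (N : ℕ) : ℝ :=
  ∫ ω, (drift Z Q lam ρ T + |ρ| * Z (lam * T) ω) ^ N ∂Q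

end BNS

end

/-! Put `X = drift + |ρ| Z_{λT}`. Since `Z ≥ 0` and `κ(ρ) ≤ 0`, the bound `|P_T - 1| ≤ X` holds
almost surely: convexity of `exp` gives the upper side (trapezoid rule) and `1 + x ≤ exp x` the
lower. Raising to the power `N` and integrating gives the estimate. The recursion is the
moment–cumulant recursion for `X`, from `M' = K' M` for its moment and cumulant generating
functions. The cumulants of `X` are explicit because independent stationary increments make the
cumulant generating function of `Z t` equal to `t κ` (`IsSubordinator.cgf_eq_mul_kappa`). -/

namespace BNS

/-! ### Real analysis -/

/-- The trapezoid bound for the exponential on `[0, ∞)`. -/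
theorem exp_sub_one_le_trapezoid {x : ℝ} (hx : 0 ≤ x) :
    Real.exp x - 1 ≤ x * (1 / 2 * Real.exp x + 1 / 2) := by
  have hd : ∀ y : ℝ, HasDerivAt (fun x => x * (1 / 2 * Real.exp x + 1 / 2) - (Real.exp x - 1))
      (1 * (1 / 2 * Real.exp y + 1 / 2) + y * (1 / 2 * Real.exp y) - Real.exp y) y := fun y =>
    ((hasDerivAt_id' y).mul (((Real.hasDerivAt_exp y).const_mul (1 / 2)).add_const (1 / 2))).sub
      ((Real.hasDerivAt_exp y).sub_const 1)
  have hm : MonotoneOn (fun x => x * (1 / 2 * Real.exp x + 1 / 2) - (Real.exp x - 1))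
      (Set.Ici 0) := by
    refine monotoneOn_of_deriv_nonneg (convex_Ici 0)
      (fun y _ => (hd y).continuousAt.continuousWithinAt)
      (fun y _ => (hd y).differentiableAt.differentiableWithinAt) fun y _ => ?_
    rw [(hd y).deriv]
    -- The derivative is `(1 - (1 - y) exp y) / 2`, nonnegative because `1 - y ≤ exp (-y)`.
    have h1 : Real.exp (-y) * Real.exp y = 1 := by rw [← Real.exp_add]; simp
    nlinarith [mul_le_mul_of_nonneg_right (Real.add_one_le_exp (-y)) (Real.exp_pos y).le]
  have := hm (Set.mem_Ici.2 le_rfl) (Set.mem_Ici.2 hx) hx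
  norm_num at this
  linarith

/-- If `a ≤ 0` and `y ≥ 0`, then `exp (-a - y) - 1` is dominated by the trapezoid bound at `-a`
plus `y`. -/
theorem abs_exp_sub_one_le {a y : ℝ} (ha : a ≤ 0) (hy : 0 ≤ y) :
    |Real.exp (-y - a) - 1| ≤ -a * (1 / 2 * Real.exp (-a) + 1 / 2) + y := by
  have h1 := exp_sub_one_le_trapezoid (neg_nonneg.2 ha)
  have h2 : 1 ≤ Real.exp (-a) := Real.one_le_exp (neg_nonneg.2 ha)
  have h3 : Real.exp (-y - a) ≤ Real.exp (-a) := Real.exp_le_exp.2 (by linarith)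
  have h4 := Real.add_one_le_exp (-y - a)
  rw [abs_le]
  constructor <;> linarith

/-- A nonnegative additive function on `[0, ∞)` is linear. -/
theorem eq_mul_of_additive_of_nonneg {f : ℝ≥0 → ℝ} (hadd : ∀ s t, f (s + t) = f s + f t)
    (hf : ∀ t, 0 ≤ f t) (t : ℝ≥0) : f t = t * f 1 := by
  have h0 : f 0 = 0 := by simpa using hadd 0 0
  let F : ℝ≥0 →+ ℝ := { toFun := f, map_zero' := h0, map_add' := hadd }
  have hn (n : ℕ) (s : ℝ≥0) : f (n * s) = n * f s := by
    simpa [F] using map_nsmul F n s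
  have hmono : Monotone f := fun s u hsu => by
    obtain ⟨v, rfl⟩ := exists_add_of_le hsu
    rw [hadd]
    linarith [hf v]
  -- Monotonicity squeezes `f (n t)` between the floor and ceiling of `n t` times `f 1`, so the
  -- error stays bounded as `n` grows.
  have key (n : ℕ) : n * |f t - t * f 1| ≤ f 1 := by
    have hup : f (n * t) ≤ ⌈(n : ℝ≥0) * t⌉₊ * f 1 := by
      rw [← hn, mul_one]
      exact hmono (Nat.le_ceil _)
    have hlo : ⌊(n : ℝ≥0) * t⌋₊ * f 1 ≤ f (n * t) := by
      rw [← hn, mul_one]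
      exact hmono (Nat.floor_le zero_le)
    have hc : (⌈(n : ℝ≥0) * t⌉₊ : ℝ) ≤ n * t + 1 := by
      exact_mod_cast (Nat.ceil_lt_add_one (zero_le (a := (n : ℝ≥0) * t))).le
    have hfl : (n * t : ℝ) ≤ ⌊(n : ℝ≥0) * t⌋₊ + 1 := by
      exact_mod_cast (Nat.lt_floor_add_one ((n : ℝ≥0) * t)).le
    rw [hn] at hup hlo
    have h1 := mul_le_mul_of_nonneg_right hc (hf 1)
    have h2 := mul_le_mul_of_nonneg_right hfl (hf 1)
    rw [← Nat.abs_cast n, ← abs_mul, abs_le]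
    constructor <;> linarith
  by_contra hne
  have hpos : 0 < |f t - t * f 1| := abs_pos.2 (sub_ne_zero.2 hne)
  obtain ⟨n, hlt⟩ := exists_nat_gt (f 1 / |f t - t * f 1|)
  rw [div_lt_iff₀ hpos] at hlt
  linarith [key n]

theorem iteratedDeriv_comp_const_mul_left (f : ℝ → ℝ) (c : ℝ) (n : ℕ) (x : ℝ) :
    iteratedDeriv n (fun y => f (c * y)) x = c ^ n * iteratedDeriv n f (c * x) := by
  induction n generalizing x with
  | zero => simp
  | succ n ih =>
    have h := deriv_comp_mul_left c (iteratedDeriv n f) x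
    rw [iteratedDeriv_succ, funext ih, deriv_const_mul_field, h, iteratedDeriv_succ, smul_eq_mul,
      pow_succ, mul_assoc]

/-! ### Moments and cumulants -/

section Moments

variable {Ω : Type*} [MeasurableSpace Ω] {μ : Measure Ω} {X : Ω → ℝ}

theorem integrableExpSet_const_add_mul (d c θ : ℝ) (h : c * θ ∈ integrableExpSet X μ) :
    θ ∈ integrableExpSet (fun ω => d + c * X ω) μ := by
  refine (Integrable.const_mul h (Real.exp (θ * d))).congr (ae_of_all _ fun ω => ?_)
  simp only [← Real.exp_add]
  congr 1
  ring

theorem zero_mem_interior_integrableExpSet_const_add_mul (d c : ℝ)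
    (h0 : 0 ∈ interior (integrableExpSet X μ)) :
    0 ∈ interior (integrableExpSet (fun ω => d + c * X ω) μ) := by
  rw [mem_interior_iff_mem_nhds] at h0 ⊢
  have ht : Tendsto (fun θ : ℝ => c * θ) (𝓝 0) (𝓝 0) := by
    simpa using (continuous_const_mul c).tendsto (0 : ℝ)
  filter_upwards [ht h0] with θ hθ using integrableExpSet_const_add_mul d c θ hθ

variable [IsProbabilityMeasure μ]

/-- The recursion expressing moments through cumulants. -/
theorem integral_pow_succ_eq_sum_cumulant (h0 : 0 ∈ interior (integrableExpSet X μ)) (n : ℕ) :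
    ∫ ω, X ω ^ (n + 1) ∂μ = ∑ j ∈ Finset.range (n + 1),
      (n.choose j : ℝ) * iteratedDeriv (j + 1) (cgf X μ) 0 * ∫ ω, X ω ^ (n - j) ∂μ := by
  have hm (k : ℕ) : ∫ ω, X ω ^ k ∂μ = iteratedDeriv k (mgf X μ) 0 := by
    simp [iteratedDeriv_mgf_zero h0 k]
  -- The identity `M' = K' M` near `0`; Leibniz's rule for its `n`-th derivative at `0` is the
  -- recursion.
  have hev : deriv (mgf X μ) =ᶠ[𝓝 0] deriv (cgf X μ) * mgf X μ := by
    filter_upwards [isOpen_interior.eventually_mem h0] with v hv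
    rw [Pi.mul_apply, deriv_cgf hv, deriv_mgf hv,
      div_mul_cancel₀ _ (mgf_pos (interior_subset (s := integrableExpSet X μ) hv)).ne']
  rw [hm, iteratedDeriv_succ', hev.iteratedDeriv_eq,
    iteratedDeriv_mul (analyticAt_cgf h0).deriv.contDiffAt (analyticAt_mgf h0).contDiffAt]
  exact Finset.sum_congr rfl fun j _ => by rw [hm, iteratedDeriv_succ']

theorem cgf_const_add_mul (d c θ : ℝ) (h : c * θ ∈ integrableExpSet X μ) :
    cgf (fun ω => d + c * X ω) μ θ = θ * d + cgf X μ (c * θ) := by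
  rw [cgf, mgf_const_add, mgf_const_mul, Real.log_mul (Real.exp_pos _).ne' (mgf_pos h).ne',
    Real.log_exp, cgf]

/-- Translation adds a linear term to the cumulant generating function, so only the first cumulant
sees `d`. -/
theorem iteratedDeriv_cgf_const_add_mul (d c : ℝ) (h0 : 0 ∈ interior (integrableExpSet X μ))
    (n : ℕ) :
    iteratedDeriv n (cgf (fun ω => d + c * X ω) μ) 0 =
      (if n = 1 then d else 0) + c ^ n * iteratedDeriv n (cgf X μ) 0 := by
  have ht : Tendsto (fun θ : ℝ => c * θ) (𝓝 0) (𝓝 0) := by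
    simpa using (continuous_const_mul c).tendsto (0 : ℝ)
  have hev : cgf (fun ω => d + c * X ω) μ =ᶠ[𝓝 0] fun θ => θ * d + cgf X μ (c * θ) := by
    filter_upwards [ht (mem_interior_iff_mem_nhds.1 h0)] with θ hθ
      using cgf_const_add_mul d c θ hθ
  have hc : ContDiffAt ℝ n (fun θ => cgf X μ (c * θ)) 0 := by
    refine ContDiffAt.comp (0 : ℝ) (g := cgf X μ) (f := fun θ => c * θ) ?_ (by fun_prop)
    rw [mul_zero]
    exact (analyticAt_cgf h0).contDiffAt
  rw [hev.iteratedDeriv_eq, iteratedDeriv_fun_add (by fun_prop) hc,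
    iteratedDeriv_comp_const_mul_left, mul_zero, iteratedDeriv_mul_const_field,
    iteratedDeriv_fun_id_zero]
  simp

end Moments

/-! ### Subordinators -/

section Subordinator

variable {Ω : Type*} [MeasurableSpace Ω] {Q : Measure Ω} {Z : ℝ≥0 → Ω → ℝ}

theorem IsSubordinator.ae_nonneg (hZ : IsSubordinator Z Q) (t : ℝ≥0) : ∀ᵐ ω ∂Q, 0 ≤ Z t ω := by
  filter_upwards [hZ.zero, hZ.mono] with ω h0 hm
  rw [← h0]
  exact hm zero_le

theorem IsLevyProcess.indepFun_increment (hZ : IsLevyProcess Z Q) (s t : ℝ≥0) :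
    IndepFun (Z s) (fun ω => Z (s + t) ω - Z s ω) Q :=
  hZ.indep.indepFun_eval_sub (r := 0) zero_le le_self_add hZ.zero

theorem IsLevyProcess.integrable_exp_increment (hZ : IsLevyProcess Z Q) {θ : ℝ} (s : ℝ≥0)
    {t : ℝ≥0} (ht : Integrable (fun ω => Real.exp (θ * Z t ω)) Q) :
    Integrable (fun ω => Real.exp (θ * (Z (s + t) ω - Z s ω))) Q :=
  ((hZ.stationary s t).comp (u := fun x : ℝ => Real.exp (θ * x))
    (by fun_prop)).integrable_iff.2 ht

theorem IsLevyProcess.integrable_exp_add (hZ : IsLevyProcess Z Q) {θ : ℝ} {s t : ℝ≥0}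
    (hs : Integrable (fun ω => Real.exp (θ * Z s ω)) Q)
    (ht : Integrable (fun ω => Real.exp (θ * Z t ω)) Q) :
    Integrable (fun ω => Real.exp (θ * Z (s + t) ω)) Q := by
  simpa using (hZ.indepFun_increment s t).integrable_exp_mul_add hs
    (hZ.integrable_exp_increment s ht)

theorem IsLevyProcess.cgf_add (hZ : IsLevyProcess Z Q) {θ : ℝ} {s t : ℝ≥0}
    (hs : Integrable (fun ω => Real.exp (θ * Z s ω)) Q)
    (ht : Integrable (fun ω => Real.exp (θ * Z t ω)) Q) :
    cgf (Z (s + t)) Q θ = cgf (Z s) Q θ + cgf (Z t) Q θ := by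
  have h := (hZ.indepFun_increment s t).cgf_add hs (hZ.integrable_exp_increment s ht)
  have h1 : Z s + (fun ω => Z (s + t) ω - Z s ω) = Z (s + t) := by
    ext ω
    simp
  rw [h1] at h
  rw [h, cgf, cgf, cgf, mgf_congr_identDistrib (hZ.stationary s t)]

theorem mem_integrableExpSet_of_nonpos [IsProbabilityMeasure Q] {X : Ω → ℝ} (hX : Measurable X)
    (h0 : ∀ᵐ ω ∂Q, 0 ≤ X ω) {θ : ℝ} (hθ : θ ≤ 0) : θ ∈ integrableExpSet X Q := by
  refine (integrable_const (1 : ℝ)).mono' (by fun_prop) ?_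
  filter_upwards [h0] with ω hω
  rw [Real.norm_eq_abs, Real.abs_exp, Real.exp_le_one_iff]
  exact mul_nonpos_of_nonpos_of_nonneg hθ hω

/-- For `θ ≥ 0`, integer times follow by adding independent increments, and monotone paths dominate
`Z t` by `Z ⌈t⌉₊`. -/
theorem IsSubordinator.integrable_exp [IsProbabilityMeasure Q] (hZ : IsSubordinator Z Q) {θ : ℝ}
    (hθ : θ ∈ kappaDomain Z Q) (t : ℝ≥0) : θ ∈ integrableExpSet (Z t) Q := by
  rcases le_total θ 0 with h | h
  · exact mem_integrableExpSet_of_nonpos (hZ.measurable t) (hZ.ae_nonneg t) h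
  have hn (n : ℕ) : Integrable (fun ω => Real.exp (θ * Z n ω)) Q := by
    induction n with
    | zero =>
      refine (integrable_const (1 : ℝ)).congr ?_
      filter_upwards [hZ.zero] with ω hω
      simp [hω]
    | succ n ih =>
      push_cast
      exact hZ.integrable_exp_add ih hθ
  refine (hn ⌈t⌉₊).mono' ?_ ?_
  · have := hZ.measurable t
    fun_prop
  · filter_upwards [hZ.mono] with ω hω
    rw [Real.norm_eq_abs, Real.abs_exp, Real.exp_le_exp]
    exact mul_le_mul_of_nonneg_left (hω (Nat.le_ceil t)) h

/-- The cumulant generating function of a subordinator is linear in time. -/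
theorem IsSubordinator.cgf_eq_mul_kappa [IsProbabilityMeasure Q] (hZ : IsSubordinator Z Q) {θ : ℝ}
    (hθ : θ ∈ kappaDomain Z Q) (t : ℝ≥0) : cgf (Z t) Q θ = t * kappa Z Q θ := by
  have hadd (s t : ℝ≥0) : cgf (Z (s + t)) Q θ = cgf (Z s) Q θ + cgf (Z t) Q θ :=
    hZ.cgf_add (hZ.integrable_exp hθ s) (hZ.integrable_exp hθ t)
  have h1 : ∫ _ : Ω, (1 : ℝ) ∂Q = 1 := by simp
  -- The sign of `θ` fixes the sign of the cumulant generating function for all `t`, so additivity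
  -- in time forces linearity.
  rcases le_total 0 θ with h | h
  · refine eq_mul_of_additive_of_nonneg (f := fun t => cgf (Z t) Q θ) hadd
      (fun t => Real.log_nonneg ?_) t
    rw [mgf, ← h1]
    refine integral_mono_ae (integrable_const _) (hZ.integrable_exp hθ t) ?_
    filter_upwards [hZ.ae_nonneg t] with ω hω
    exact Real.one_le_exp (mul_nonneg h hω)
  · have := eq_mul_of_additive_of_nonneg (f := fun t => -cgf (Z t) Q θ)
      (fun s t => by rw [hadd]; ring)
      (fun t => neg_nonneg.2 <| Real.log_nonpos mgf_nonneg ?_) t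
    · rw [kappa]
      linarith
    · rw [mgf, ← h1]
      refine integral_mono_ae (hZ.integrable_exp hθ t) (integrable_const _) ?_
      filter_upwards [hZ.ae_nonneg t] with ω hω
      exact Real.exp_le_one_iff.2 (mul_nonpos_of_nonpos_of_nonneg h hω)

theorem IsSubordinator.kappa_nonpos [IsProbabilityMeasure Q] (hZ : IsSubordinator Z Q) {θ : ℝ}
    (hθ : θ ≤ 0) : kappa Z Q θ ≤ 0 := by
  have h1 : ∫ _ : Ω, (1 : ℝ) ∂Q = 1 := by simp
  refine Real.log_nonpos mgf_nonneg ?_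
  rw [mgf, ← h1]
  refine integral_mono_ae
    (mem_integrableExpSet_of_nonpos (hZ.measurable 1) (hZ.ae_nonneg 1) hθ)
    (integrable_const _) ?_
  filter_upwards [hZ.ae_nonneg 1] with ω hω
  exact Real.exp_le_one_iff.2 (mul_nonpos_of_nonpos_of_nonneg hθ hω)

theorem IsSubordinator.ae_abs_P_sub_one_le [IsProbabilityMeasure Q] (hZ : IsSubordinator Z Q)
    (lam T : ℝ≥0) {ρ : ℝ} (hρ : ρ ≤ 0) :
    ∀ᵐ ω ∂Q, |P Z Q lam ρ T ω - 1| ≤ drift Z Q lam ρ T + |ρ| * Z (lam * T) ω := by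
  filter_upwards [hZ.ae_nonneg (lam * T)] with ω hω
  have ha : lam * T * kappa Z Q ρ ≤ 0 :=
    mul_nonpos_of_nonneg_of_nonpos (by positivity) (hZ.kappa_nonpos hρ)
  have h := abs_exp_sub_one_le ha (mul_nonneg (abs_nonneg ρ) hω)
  rw [abs_of_nonpos hρ] at h ⊢
  rw [neg_mul, neg_neg] at h
  rwa [P, drift, neg_mul ρ]

theorem IsSubordinator.iteratedDeriv_cgf_zero [IsProbabilityMeasure Q] (hZ : IsSubordinator Z Q)
    (h0 : 0 ∈ interior (kappaDomain Z Q)) (t : ℝ≥0) (n : ℕ) :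
    iteratedDeriv n (cgf (Z t) Q) 0 = t * iteratedDeriv n (kappa Z Q) 0 := by
  have hev : cgf (Z t) Q =ᶠ[𝓝 0] fun θ => t * kappa Z Q θ := by
    filter_upwards [mem_interior_iff_mem_nhds.1 h0] with θ hθ using hZ.cgf_eq_mul_kappa hθ t
  rw [hev.iteratedDeriv_eq, iteratedDeriv_const_mul_field]

end Subordinator

end BNS

theorem mainTheorem7 {Ω : Type*} [MeasurableSpace Ω] (Q : Measure Ω) [IsProbabilityMeasure Q]
    (Z : ℝ≥0 → Ω → ℝ) (hZ : BNS.IsSubordinator Z Q) (hκ : 0 < BNS.kappaHat Z Q)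
    (lam T : ℝ≥0) (hlam : 0 < lam) (hT : 0 < T) (ρ : ℝ) (hρ : ρ ≤ 0) (N : ℕ)
    (hN : ∃ a b : ℝ, a < 0 ∧ 0 < b ∧ Set.Ioo a b ⊆ BNS.kappaDomain Z Q ∧
      ContDiffOn ℝ N (BNS.kappa Z Q) (Set.Ioo a b)) :
    Integrable (fun ω => (BNS.P Z Q lam ρ T ω - 1) ^ N) Q ∧
    (∀ h ≤ N, Integrable
      (fun ω => (BNS.drift Z Q lam ρ T + |ρ| * Z (lam * T) ω) ^ h) Q) ∧
    |∫ ω, (BNS.P Z Q lam ρ T ω - 1) ^ N ∂Q| ≤ BNS.G Z Q lam ρ T N ∧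
    BNS.G Z Q lam ρ T 0 = 1 ∧
    ∀ h : ℕ, 1 ≤ h → h ≤ N →
      BNS.G Z Q lam ρ T h =
        -(lam * T * BNS.kappa Z Q ρ) *
            (1 / 2 * Real.exp (-(lam * T * BNS.kappa Z Q ρ)) + 1 / 2) *
            BNS.G Z Q lam ρ T (h - 1) +
          ∑ i ∈ Finset.Icc 1 h, ((h - 1).choose (i - 1) : ℝ) * BNS.G Z Q lam ρ T (h - i) *
            iteratedDeriv i (BNS.kappa Z Q) 0 * lam * T * |ρ| ^ i := by
  obtain ⟨a, b, ha, hb, hab, -⟩ := hN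
  have h0 : 0 ∈ interior (BNS.kappaDomain Z Q) :=
    mem_interior_iff_mem_nhds.2 (mem_of_superset (Ioo_mem_nhds ha hb) hab)
  have h0t : 0 ∈ interior (integrableExpSet (Z (lam * T)) Q) :=
    interior_mono (fun θ hθ => hZ.integrable_exp hθ _) h0
  have h0X := BNS.zero_mem_interior_integrableExpSet_const_add_mul
    (BNS.drift Z Q lam ρ T) |ρ| h0t
  have hint (h : ℕ) := integrable_pow_of_mem_interior_integrableExpSet h0X h
  have hbound : ∀ᵐ ω ∂Q, ‖(BNS.P Z Q lam ρ T ω - 1) ^ N‖ ≤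
      (BNS.drift Z Q lam ρ T + |ρ| * Z (lam * T) ω) ^ N := by
    filter_upwards [hZ.ae_abs_P_sub_one_le lam T hρ] with ω hω
    rw [norm_pow, Real.norm_eq_abs]
    exact pow_le_pow_left₀ (abs_nonneg _) hω N
  have hmeas : Measurable fun ω => (BNS.P Z Q lam ρ T ω - 1) ^ N := by
    have := hZ.measurable (lam * T)
    unfold BNS.P
    fun_prop
  refine ⟨(hint N).mono' hmeas.aestronglyMeasurable hbound, fun h _ => hint h,
    norm_integral_le_of_norm_le (hint N) hbound, by simp [BNS.G], fun h h1 _ => ?_⟩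
  obtain ⟨n, rfl⟩ := Nat.exists_eq_add_of_le' h1
  have hrec := BNS.integral_pow_succ_eq_sum_cumulant h0X n
  simp only [BNS.iteratedDeriv_cgf_const_add_mul _ _ h0t, hZ.iteratedDeriv_cgf_zero h0, mul_add,
    add_mul, Finset.sum_add_distrib] at hrec
  rw [BNS.G, hrec, ← Finset.Ico_add_one_right_eq_Icc, Finset.sum_Ico_eq_sum_range, Nat.add_sub_cancel,
    Nat.add_sub_cancel]
  congr 1
  -- The drift enters only the first cumulant, so only `j = 0` survives; in the other sum `i = j +
  -- 1`.
  · rw [Finset.sum_eq_single_of_mem 0 (by simp) (fun j _ hj => by simp [hj])]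
    simp [BNS.G, BNS.drift, add_mul, mul_add]
  · refine Finset.sum_congr rfl fun j _ => ?_
    rw [BNS.G, add_comm 1 j, Nat.add_sub_cancel, Nat.add_sub_add_right]
    push_cast
    ring
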